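/- Let $A,\Omega,\Theta$ be finite sets ($A\neq\emptyset$) and let $B\subset\mathbb R_{\ge 0}$ be a finite set of budgets. A seller observes $\omega\in\Omega$ and has a publicly known budget $M\ge 0$. A buyer observes $\theta\in\Theta$, has a budget $b\in B$, and takes an action $a\in A$ with utility $u(\omega,\theta,a)$. The triple $(\omega,\theta,b)$ is drawn from a commonly known prior $\mu$, which is arbitrary; in particular $\omega$ and $\theta$ may be correlated. A generic interactive protocol is a finite tree with three kinds of non-leaf nodes. At a seller node the seller moves to a random child, with a distribution that depends on $\omega$. At a buyer node the buyer moves to a (possibly random) child of his choice. A transfer node has one child and a real payment $t$ from the buyer to the seller. At every node of the tree the net transfer from the seller to the buyer is at most $M$. The buyer may leave at any node, and he never visits a node at which his net payment exceeds his budget $b$. Where the execution ends, he takes an action that is optimal for his Bayesian posterior on $\omega$; his utility is the expected utility of that action minus his net payment. He plays a strategy that maximizes his expected utility given $(\theta,b)$. The revenue is the expected net payment from the buyer to the seller. If the budget is private, the seller posts a single protocol; if it is public, she may post one protocol for each $b\in B$ (a fixed public budget is the case $|B|=1$). A consulting mechanism with probabilistic return (CM-probR) is given by distributions $p_{\theta,b}(\omega)$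 on $A\times\{+,-\}$ for all $\theta\in\Theta$, $b\in B$, $\omega\in\Omega$. The buyer reports $(\hat\theta,\hat b)$ (only $\hat\theta$, with $\hat b=b$, if the budget is public) and deposits $\hat b$. The seller then draws $[a,i]\sim p_{\hat\theta,\hat b}(\omega)$ and recommends $a$. She returns $\hat b+M$ if $i=-$, and $0$ if $i=+$. The policy is required to be obedient: for a truthful buyer, the action $a$ is optimal given the posterior after $[a,i]$. The mechanism is IC if truthful reporting followed by full participation is an optimal strategy of every buyer, among all his strategies including leaving at any point. Theorem. Both for public and for private buyer budgets there is an obedient IC CM-probR that maximizes the seller's revenue over all generic interactive protocols: it is itself such a protocol, and its revenue under truthful participation is at least the revenue of every generic interactive protocol under any optimal buyer behaviour. -/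

import Mathlib

namespace InfoSale

/-- The finite data of the problem: seller signals `Ω`, buyer signals `Θ`, buyer actions `A`,
the finite set `B` of possible buyer budgets, the buyer's utility `u`, the common prior `μ` on
triples `(ω, θ, b)` (arbitrary, so signals and budget may be correlated), and the publicly known
seller budget `M`. -/
structure Environment (Ω Θ A : Type) [Fintype Ω] [Fintype Θ] [Fintype A] where
  B : Finset ℝ
  u : Ω → Θ → A → ℝ
  μ : stdSimplex ℝ (Ω × Θ × B)
  M : ℝ
  M_nonneg : 0 ≤ M
  budget_nonneg : ∀ b ∈ B, 0 ≤ b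

/-- Protocol trees.  `p ω` is the distribution of the seller's move at a seller node when her signal
is `ω`; `t` is the payment from the buyer to the seller at a transfer node (possibly negative). -/
inductive Protocol (Ω : Type) : Type 1
  | leaf : Protocol Ω
  | seller (C : Type) [Fintype C] (p : Ω → stdSimplex ℝ C) (child : C → Protocol Ω) : Protocol Ω
  | buyer (C : Type) [Fintype C] (child : C → Protocol Ω) : Protocol Ω
  | transfer (t : ℝ) (child : Protocol Ω) : Protocol Ω

namespace Protocol

variable {Ω : Type}

/-- The nodes of a protocol tree; `none` is the root of the current subtree. -/
def Node : Protocol Ω → Type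
  | leaf => Unit
  | seller C _ child => Option (Σ c : C, Node (child c))
  | buyer C child => Option (Σ c : C, Node (child c))
  | transfer _ child => Option (Node child)

/-- A protocol tree has finitely many nodes. -/
noncomputable instance nodeFintype : (P : Protocol Ω) → Fintype (Node P)
  | leaf => inferInstanceAs (Fintype Unit)
  | seller C _ child =>
      have : (c : C) → Fintype (Node (child c)) := fun c => nodeFintype (child c)
      inferInstanceAs (Fintype (Option (Σ c : C, Node (child c))))
  | buyer C child =>
      have : (c : C) → Fintype (Node (child c)) := fun c => nodeFintype (child c)
      inferInstanceAs (Fintype (Option (Σ c : C, Node (child c))))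
  | transfer _ child =>
      have := nodeFintype child
      inferInstanceAs (Fintype (Option (Node child)))

/-- The summed transfer from the buyer to the seller on the path from the root to a node. -/
def net : (P : Protocol Ω) → Node P → ℝ
  | leaf, _ => 0
  | seller _ _ _, none => 0
  | seller _ _ child, some ⟨c, z⟩ => net (child c) z
  | buyer _ _, none => 0
  | buyer _ child, some ⟨c, z⟩ => net (child c) z
  | transfer _ _, none => 0
  | transfer t child, some z => t + net child z

/-- The net transfer from the seller to the buyer never exceeds `M`, at any node. -/
def WithinSellerBudget (M : ℝ) (P : Protocol Ω) : Prop :=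
  ∀ z : Node P, -(net P z) ≤ M

/-- A (randomized) strategy of a given buyer.  At each seller or transfer node it gives the
probability of leaving the protocol there; at a buyer node it gives a distribution over the children
together with the option `none` of leaving there. -/
def Strategy : Protocol Ω → Type
  | leaf => Unit
  | seller C _ child => unitInterval × ((c : C) → Strategy (child c))
  | buyer C child => stdSimplex ℝ (Option C) × ((c : C) → Strategy (child c))
  | transfer _ child => unitInterval × Strategy child

/-- The probability that the execution ends at a given node (a leaf, or a node at which the buyer
leaves), when the seller's signal is `ω` and the buyer follows the strategy. -/
noncomputable def endProb : (P : Protocol Ω) → Strategy P → Ω → Node P → ℝ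
  | leaf, _, _, _ => 1
  | seller _ _ _, s, _, none => (s.1 : ℝ)
  | seller _ p child, s, ω, some ⟨c, z⟩ =>
      (1 - (s.1 : ℝ)) * (p ω : _ → ℝ) c * endProb (child c) (s.2 c) ω z
  | buyer _ _, s, _, none => (s.1 : _ → ℝ) none
  | buyer _ child, s, ω, some ⟨c, z⟩ =>
      (s.1 : _ → ℝ) (some c) * endProb (child c) (s.2 c) ω z
  | transfer _ _, s, _, none => (s.1 : ℝ)
  | transfer _ child, s, ω, some z => (1 - (s.1 : ℝ)) * endProb child s.2 ω z

/-- A buyer with budget `b` who has already paid `paid` never visits a node at which the net transfer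
exceeds `b`: at every transfer node, either he leaves for sure or the payment keeps him within his
budget (and so does his continuation). -/
def Affordable (b : ℝ) : (P : Protocol Ω) → Strategy P → (paid : ℝ) → Prop
  | leaf, _, _ => True
  | seller _ _ child, s, paid => ∀ c, Affordable b (child c) (s.2 c) paid
  | buyer _ child, s, paid => ∀ c, Affordable b (child c) (s.2 c) paid
  | transfer t child, s, paid =>
      (s.1 : ℝ) = 1 ∨ (paid + t ≤ b ∧ Affordable b child s.2 (paid + t))

end Protocol

section

variable {Ω Θ A : Type} [Fintype Ω] [Fintype Θ] [Fintype A]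

/-- The probability of an event of likelihood `l ω` given `ω`, under the belief `q` on `Ω`. -/
noncomputable def evidence (q l : Ω → ℝ) : ℝ := ∑ ω, q ω * l ω

/-- Bayes update of the belief `q` after an event of likelihood `l ω` given `ω`. -/
noncomputable def bayes (q l : Ω → ℝ) (ω : Ω) : ℝ := q ω * l ω / evidence q l

namespace Environment

/-- `μ(θ, b)`. -/
noncomputable def typeProb (e : Environment Ω Θ A) (θ : Θ) (b : e.B) : ℝ :=
  ∑ ω, (e.μ : _ → ℝ) (ω, θ, b)

/-- `μ(ω | θ, b)`: the initial belief of a buyer of type `θ` and budget `b`. -/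
noncomputable def belief (e : Environment Ω Θ A) (θ : Θ) (b : e.B) (ω : Ω) : ℝ :=
  (e.μ : _ → ℝ) (ω, θ, b) / e.typeProb θ b

/-- The expected utility of the best action of type `θ` under the belief `q`. -/
noncomputable def bestValue [Nonempty A] (e : Environment Ω Θ A) (θ : Θ) (q : Ω → ℝ) : ℝ :=
  Finset.univ.sup' Finset.univ_nonempty fun a : A => ∑ ω, e.u ω θ a * q ω

/-- The expected utility of buyer `(θ, b)` who follows the strategy `s` in the protocol `P`. -/
noncomputable def utility [Nonempty A] (e : Environment Ω Θ A) (θ : Θ) (b : e.B)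
    (P : Protocol Ω) (s : P.Strategy) : ℝ :=
  ∑ z : P.Node, evidence (e.belief θ b) (fun ω => P.endProb s ω z) *
    (e.bestValue θ (bayes (e.belief θ b) fun ω => P.endProb s ω z) - P.net z)

/-- The expected net payment of buyer `(θ, b)` who follows the strategy `s` in `P`. -/
noncomputable def expectedPayment (e : Environment Ω Θ A) (θ : Θ) (b : e.B)
    (P : Protocol Ω) (s : P.Strategy) : ℝ :=
  ∑ z : P.Node, evidence (e.belief θ b) (fun ω => P.endProb s ω z) * P.net z

/-- `s` is an optimal strategy of buyer `(θ, b)` in `P`, among all strategies within his budget. -/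
def IsBestResponse [Nonempty A] (e : Environment Ω Θ A) (θ : Θ) (b : e.B)
    (P : Protocol Ω) (s : P.Strategy) : Prop :=
  P.Affordable b s 0 ∧
    ∀ s' : P.Strategy, P.Affordable b s' 0 → e.utility θ b P s' ≤ e.utility θ b P s

/-- What the seller may run when she observes the buyer's budget: one protocol for each budget. -/
def publicDesigns (e : Environment Ω Θ A) : Set (e.B → Protocol Ω) :=
  {P | ∀ b, (P b).WithinSellerBudget e.M}

/-- What the seller may run when she does not observe the budget: a single protocol. -/
def privateDesigns (e : Environment Ω Θ A) : Set (e.B → Protocol Ω) :=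
  {P | ∃ P₀ : Protocol Ω, P₀.WithinSellerBudget e.M ∧ P = fun _ => P₀}

/-- The expected revenue when buyer `(θ, b)` follows `s θ b` in the protocol `P b`. -/
noncomputable def revenue (e : Environment Ω Θ A) (P : e.B → Protocol Ω)
    (s : (θ : Θ) → (b : e.B) → (P b).Strategy) : ℝ :=
  ∑ θ, ∑ b : e.B, e.typeProb θ b * e.expectedPayment θ b (P b) (s θ b)

/-- Every buyer acts optimally. -/
def IsRational [Nonempty A] (e : Environment Ω Θ A) (P : e.B → Protocol Ω)
    (s : (θ : Θ) → (b : e.B) → (P b).Strategy) : Prop :=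
  ∀ θ b, e.IsBestResponse θ b (P b) (s θ b)

/-- `P` is admissible, `s` is optimal buyer behaviour in `P`, and the resulting revenue is at least
the revenue of every admissible `Q` under every optimal buyer behaviour in `Q`. -/
def MaximizesRevenue [Nonempty A] (e : Environment Ω Θ A) (designs : Set (e.B → Protocol Ω))
    (P : e.B → Protocol Ω) (s : (θ : Θ) → (b : e.B) → (P b).Strategy) : Prop :=
  P ∈ designs ∧ e.IsRational P s ∧
    ∀ Q ∈ designs, ∀ r : (θ : Θ) → (b : e.B) → (Q b).Strategy,
      e.IsRational Q r → e.revenue Q r ≤ e.revenue P s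

/-- A recommendation policy: for each report `(θ, b)` and seller signal `ω`, a distribution over
pairs of a recommended action and an indicator (`true`: the full amount `b + M` is returned,
`false`: nothing is returned). -/
abbrev Policy (e : Environment Ω Θ A) : Type := Θ → e.B → Ω → stdSimplex ℝ (A × Bool)

/-- Each recommended action is optimal for the truthful buyer, given all he has observed. -/
def Obedient (e : Environment Ω Θ A) (p : e.Policy) : Prop :=
  ∀ (θ : Θ) (b : e.B) (a : A) (i : Bool) (a' : A),
    let q := bayes (e.belief θ b) fun ω => (p θ b ω : _ → ℝ) (a, i)
    ∑ ω, e.u ω θ a' * q ω ≤ ∑ ω, e.u ω θ a * q ω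

/-- The refund for the deposit `b`. -/
noncomputable def refund (e : Environment Ω Θ A) (b : ℝ) (i : Bool) : ℝ :=
  if i then b + e.M else 0

/-- The consulting procedure with probabilistic return after the report `(θ, b)`: deposit of `b`,
then recommendation with indicator, then refund. -/
noncomputable def consult (e : Environment Ω Θ A) (p : e.Policy) (θ : Θ) (b : e.B) : Protocol Ω :=
  .transfer (b : ℝ) (.seller (A × Bool) (p θ b) fun ai => .transfer (-e.refund b ai.2) .leaf)

/-- The CM-probR for the publicly known budget `b`: the buyer reports only his type. -/
noncomputable def publicCMProbR (e : Environment Ω Θ A) (p : e.Policy) (b : e.B) : Protocol Ω :=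
  .buyer Θ fun θ => e.consult p θ b

/-- The CM-probR for a private budget: the buyer reports his type and his budget. -/
noncomputable def privateCMProbR (e : Environment Ω Θ A) (p : e.Policy) : Protocol Ω :=
  .buyer (Θ × e.B) fun r => e.consult p r.1 r.2

open Classical in
/-- The behaviour of a buyer with budget `b` after the report `(θ', b')`: he makes the deposit if he
can afford it (and otherwise leaves before it), and then stays until the end. -/
noncomputable def complete (e : Environment Ω Θ A) (p : e.Policy) (b : ℝ) (θ' : Θ) (b' : e.B) :
    (e.consult p θ' b').Strategy :=
  (if (b' : ℝ) ≤ b then 0 else 1, (0, fun _ => (0, ())))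

open Classical in
/-- The choice of an option with certainty. -/
noncomputable def choose {C : Type} [Fintype C] (c : C) : stdSimplex ℝ (Option C) :=
  ⟨Pi.single (some c) 1, single_mem_stdSimplex ℝ (some c)⟩

/-- Truthful reporting of the type, followed by full participation. -/
noncomputable def truthfulPublic (e : Environment Ω Θ A) (p : e.Policy) (θ : Θ) (b : e.B) :
    (e.publicCMProbR p b).Strategy :=
  (choose θ, fun θ' => e.complete p b θ' b)

/-- Truthful reporting of type and budget, followed by full participation. -/
noncomputable def truthfulPrivate (e : Environment Ω Θ A) (p : e.Policy) (θ : Θ) (b : e.B) :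
    (e.privateCMProbR p).Strategy :=
  (choose (θ, b), fun r => e.complete p b r.1 r.2)

end Environment

end

end InfoSale

/-! The proof is a revelation argument followed by compactness. Given optimal behaviour in any
protocol, replace each end node `z` by the recommendation of an action `α z` optimal there. The net
payment `x` at a reached node lies in `[-M, b]`, so a deposit `b` and a return of `b + M` with
probability `(b - x) / (b + M)` charge `x` in expectation (`sub_returnProb_mul`).

The resulting policy `garble` keeps expected payments under every belief (`sum_evidence_garble`).
Its signals are a garbling of the end nodes, so a misreporting buyer gains at most what imitating
the reported type would give (`sum_gain_garble_le`). A truthful buyer loses nothing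
(`le_sum_gain_garble`), and obedience survives pooling. Hence each protocol is matched in revenue by
an obedient incentive compatible policy (`exists_policy_of_isRational`).

Such policies form a nonempty compact set on which revenue is continuous, so a best one exists
(`exists_optimal_policy`). In the actual mechanism, leaving midway forgoes only information and
nonnegative refunds (`value_consult_le`), so the report inequalities suffice.

Multiplying posterior values by the signal's probability makes action payoffs linear and `gain`
sublinear in the likelihood, which also handles null events. -/

namespace InfoSale

/-! ### Unnormalised payoffs and the value of information -/

section Evidence

variable {Ω : Type} [Fintype Ω]

theorem evidence_nonneg {q l : Ω → ℝ} (hq : 0 ≤ q) (hl : 0 ≤ l) : 0 ≤ evidence q l :=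
  Finset.sum_nonneg fun ω _ => mul_nonneg (hq ω) (hl ω)

theorem evidence_smul (q : Ω → ℝ) (c : ℝ) (l : Ω → ℝ) :
    evidence q (fun ω => c * l ω) = c * evidence q l := by
  simp only [evidence, Finset.mul_sum]
  exact Finset.sum_congr rfl fun ω _ => by ring

theorem evidence_sum {ι : Type*} [Fintype ι] (q : Ω → ℝ) (l : ι → Ω → ℝ) :
    evidence q (fun ω => ∑ i, l i ω) = ∑ i, evidence q (l i) := by
  simp only [evidence, Finset.mul_sum]
  exact Finset.sum_comm

end Evidence

namespace Environment

variable {Ω Θ A : Type} [Fintype Ω] [Fintype Θ] [Fintype A] (e : Environment Ω Θ A)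

theorem typeProb_nonneg (θ : Θ) (b : e.B) : 0 ≤ e.typeProb θ b :=
  Finset.sum_nonneg fun _ _ => stdSimplex.zero_le _ _

theorem belief_nonneg (θ : Θ) (b : e.B) : 0 ≤ e.belief θ b := fun _ =>
  div_nonneg (stdSimplex.zero_le _ _) (e.typeProb_nonneg θ b)

/-- The utility of the action `a`, weighted by the likelihood `l` under the belief `q`. -/
noncomputable def actionGain (θ : Θ) (q : Ω → ℝ) (a : A) (l : Ω → ℝ) : ℝ :=
  ∑ ω, e.u ω θ a * (q ω * l ω)

theorem actionGain_smul (θ : Θ) (q : Ω → ℝ) (a : A) (c : ℝ) (l : Ω → ℝ) :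
    e.actionGain θ q a (fun ω => c * l ω) = c * e.actionGain θ q a l := by
  simp only [actionGain, Finset.mul_sum]
  exact Finset.sum_congr rfl fun ω _ => by ring

theorem actionGain_sum {ι : Type*} [Fintype ι] (θ : Θ) (q : Ω → ℝ) (a : A) (l : ι → Ω → ℝ) :
    e.actionGain θ q a (fun ω => ∑ i, l i ω) = ∑ i, e.actionGain θ q a (l i) := by
  simp only [actionGain, Finset.mul_sum]
  exact Finset.sum_comm

theorem sum_mul_bayes (θ : Θ) {q l : Ω → ℝ} (a : A) :
    ∑ ω, e.u ω θ a * bayes q l ω = e.actionGain θ q a l / evidence q l := by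
  simp only [bayes, actionGain, Finset.sum_div, mul_div_assoc]

theorem actionGain_eq_zero_of_evidence_eq_zero (θ : Θ) {q l : Ω → ℝ} (hq : 0 ≤ q) (hl : 0 ≤ l)
    (h : evidence q l = 0) (a : A) : e.actionGain θ q a l = 0 := by
  have h0 := (Finset.sum_eq_zero_iff_of_nonneg fun ω _ => mul_nonneg (hq ω) (hl ω)).1 h
  exact Finset.sum_eq_zero fun ω hω => by rw [h0 ω hω, mul_zero]

/-- Clearing the Bayes denominator leaves linear inequalities, which are closed and stable under
pooling signals. At a null signal both sides vanish. -/
theorem obedient_iff (p : e.Policy) :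
    e.Obedient p ↔ ∀ (θ : Θ) (b : e.B) (a : A) (i : Bool) (a' : A),
      e.actionGain θ (e.belief θ b) a' (fun ω => (p θ b ω) (a, i)) ≤
        e.actionGain θ (e.belief θ b) a (fun ω => (p θ b ω) (a, i)) := by
  refine forall₅_congr fun θ b a i a' => ?_
  have hq := e.belief_nonneg θ b
  have hl : (0 : Ω → ℝ) ≤ fun ω => (p θ b ω) (a, i) := fun ω => stdSimplex.zero_le _ _
  simp only [sum_mul_bayes]
  rcases (evidence_nonneg hq hl).eq_or_lt with h | h
  · simp [e.actionGain_eq_zero_of_evidence_eq_zero θ hq hl h.symm]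
  · exact div_le_div_iff_of_pos_right h

variable [Nonempty A]

/-- The utility of the best action, weighted by the likelihood `l` under the belief `q`. -/
noncomputable def gain (θ : Θ) (q l : Ω → ℝ) : ℝ :=
  Finset.univ.sup' Finset.univ_nonempty fun a : A => e.actionGain θ q a l

theorem actionGain_le_gain (θ : Θ) (q : Ω → ℝ) (a : A) (l : Ω → ℝ) :
    e.actionGain θ q a l ≤ e.gain θ q l :=
  Finset.le_sup' (fun a => e.actionGain θ q a l) (Finset.mem_univ a)

theorem gain_le {θ : Θ} {q l : Ω → ℝ} {x : ℝ} (h : ∀ a, e.actionGain θ q a l ≤ x) :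
    e.gain θ q l ≤ x :=
  Finset.sup'_le _ _ fun a _ => h a

theorem exists_actionGain_eq_gain (θ : Θ) (q l : Ω → ℝ) :
    ∃ a, e.actionGain θ q a l = e.gain θ q l := by
  obtain ⟨a, -, ha⟩ := Finset.exists_mem_eq_sup' (Finset.univ_nonempty (α := A))
    fun a => e.actionGain θ q a l
  exact ⟨a, ha.symm⟩

theorem gain_smul (θ : Θ) (q : Ω → ℝ) {c : ℝ} (hc : 0 ≤ c) (l : Ω → ℝ) :
    e.gain θ q (fun ω => c * l ω) = c * e.gain θ q l := by
  simp only [gain, actionGain_smul]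
  exact (Finset.mul₀_sup' hc _ _ _).symm

/-- A maximum of linear functions is subadditive: merging signals cannot help the decision maker. -/
theorem gain_sum_le {ι : Type*} [Fintype ι] (θ : Θ) (q : Ω → ℝ) (l : ι → Ω → ℝ) :
    e.gain θ q (fun ω => ∑ i, l i ω) ≤ ∑ i, e.gain θ q (l i) :=
  e.gain_le fun a => by
    rw [actionGain_sum]
    exact Finset.sum_le_sum fun i _ => e.actionGain_le_gain θ q a (l i)

theorem evidence_mul_bestValue (θ : Θ) {q l : Ω → ℝ} (hq : 0 ≤ q) (hl : 0 ≤ l) :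
    evidence q l * e.bestValue θ (bayes q l) = e.gain θ q l := by
  have h0 := evidence_nonneg hq hl
  rw [bestValue, Finset.mul₀_sup' h0, gain]
  refine Finset.sup'_congr _ rfl fun a _ => ?_
  rw [sum_mul_bayes]
  rcases h0.eq_or_lt with h | h
  · rw [← h, zero_mul, e.actionGain_eq_zero_of_evidence_eq_zero θ hq hl h.symm]
  · exact mul_div_cancel₀ _ h.ne'

end Environment

/-! ### End nodes, affordability and leaving -/

namespace Protocol

variable {Ω : Type}

theorem endProb_nonneg (P : Protocol Ω) (s : P.Strategy) (ω : Ω) (z : P.Node) :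
    0 ≤ P.endProb s ω z := by
  induction P with
  | leaf => exact zero_le_one
  | seller C p child ih =>
    rcases z with _ | ⟨c, z⟩
    · exact s.1.2.1
    · exact mul_nonneg (mul_nonneg (sub_nonneg.2 s.1.2.2) (stdSimplex.zero_le _ _)) (ih c _ z)
  | buyer C child ih =>
    rcases z with _ | ⟨c, z⟩
    · exact stdSimplex.zero_le _ _
    · exact mul_nonneg (stdSimplex.zero_le _ _) (ih c _ z)
  | transfer t child ih =>
    rcases z with _ | z
    · exact s.1.2.1
    · exact mul_nonneg (sub_nonneg.2 s.1.2.2) (ih _ z)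

theorem sum_node_seller {C : Type} [Fintype C] (p : Ω → stdSimplex ℝ C) (child : C → Protocol Ω)
    (f : (seller C p child).Node → ℝ) :
    ∑ z, f z = f none + ∑ c, ∑ z : (child c).Node, f (some ⟨c, z⟩) := by
  refine (Fintype.sum_option (α := Σ c : C, (child c).Node) f).trans ?_
  rw [Fintype.sum_sigma]

theorem sum_node_buyer {C : Type} [Fintype C] (child : C → Protocol Ω)
    (f : (buyer C child).Node → ℝ) :
    ∑ z, f z = f none + ∑ c, ∑ z : (child c).Node, f (some ⟨c, z⟩) := by
  refine (Fintype.sum_option (α := Σ c : C, (child c).Node) f).trans ?_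
  rw [Fintype.sum_sigma]

theorem sum_node_transfer (t : ℝ) (child : Protocol Ω) (f : (transfer t child).Node → ℝ) :
    ∑ z, f z = f none + ∑ z : child.Node, f (some z) :=
  Fintype.sum_option (α := child.Node) f

theorem sum_node_leaf (f : (leaf : Protocol Ω).Node → ℝ) : ∑ z, f z = f () :=
  Fintype.sum_unique (ι := Unit) f

theorem sum_endProb (P : Protocol Ω) (s : P.Strategy) (ω : Ω) : ∑ z, P.endProb s ω z = 1 := by
  induction P with
  | leaf => exact sum_node_leaf _
  | seller C p child ih =>
    rw [sum_node_seller]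
    simp only [endProb, ← Finset.mul_sum, ih, mul_one, stdSimplex.sum_eq_one]
    ring
  | buyer C child ih =>
    rw [sum_node_buyer]
    simp only [endProb, ← Finset.mul_sum, ih, mul_one]
    rw [← Fintype.sum_option (fun c => s.1 c), stdSimplex.sum_eq_one]
  | transfer t child ih =>
    rw [sum_node_transfer]
    simp only [endProb, ← Finset.mul_sum, ih, mul_one]
    ring

theorem Affordable.mono {b b' : ℝ} (h : b ≤ b') {P : Protocol Ω} {s : P.Strategy} {paid : ℝ}
    (hs : P.Affordable b s paid) : P.Affordable b' s paid := by
  induction P generalizing paid with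
  | leaf => trivial
  | seller C p child ih => exact fun c => ih c (hs c)
  | buyer C child ih => exact fun c => ih c (hs c)
  | transfer t child ih => exact hs.imp_right fun hs => ⟨hs.1.trans h, ih hs.2⟩

theorem Affordable.add_net_le {b : ℝ} {P : Protocol Ω} {s : P.Strategy} {paid : ℝ}
    (hs : P.Affordable b s paid) (hpaid : paid ≤ b) {ω : Ω} {z : P.Node}
    (hz : P.endProb s ω z ≠ 0) : paid + P.net z ≤ b := by
  induction P generalizing paid with
  | leaf => simpa [net] using hpaid
  | seller C p child ih =>
    rcases z with _ | ⟨c, z⟩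
    · simpa [net] using hpaid
    · exact ih c (hs c) hpaid (right_ne_zero_of_mul hz)
  | buyer C child ih =>
    rcases z with _ | ⟨c, z⟩
    · simpa [net] using hpaid
    · exact ih c (hs c) hpaid (right_ne_zero_of_mul hz)
  | transfer t child ih =>
    rcases z with _ | z
    · simpa [net] using hpaid
    · rcases hs with hs | hs
      · exact absurd (sub_eq_zero.2 hs.symm) (left_ne_zero_of_mul hz)
      · have := ih hs.2 hs.1 (right_ne_zero_of_mul hz)
        simpa only [net, add_assoc] using this

/-- Some strategy leaves at the root. -/
theorem exists_leave (P : Protocol Ω) (b : ℝ) :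
    ∃ s : P.Strategy, (∀ paid, P.Affordable b s paid) ∧ ∃ z, P.net z = 0 ∧
      (∀ ω, P.endProb s ω z = 1) ∧ ∀ ω z', z' ≠ z → P.endProb s ω z' = 0 := by
  induction P with
  | leaf => exact ⟨(), fun _ => trivial, (), rfl, fun _ => rfl, fun _ z h => absurd rfl h⟩
  | seller C p child ih =>
    -- The child strategies are never reached, but `Affordable` constrains them too; hence the
    -- induction carries affordability for every `paid`.
    choose s hs using ih
    refine ⟨(1, s), fun paid c => (hs c).1 paid, none, rfl, fun _ => rfl, fun ω z h => ?_⟩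
    rcases z with _ | ⟨c, z⟩
    · exact absurd rfl h
    · simp [endProb]
  | buyer C child ih =>
    classical
    choose s hs using ih
    refine ⟨(⟨Pi.single none 1, single_mem_stdSimplex ℝ none⟩, s), fun paid c => (hs c).1 paid,
      none, rfl, fun _ => ?_, fun ω z h => ?_⟩
    · exact Pi.single_eq_same (M := fun _ : Option C => ℝ) none 1
    · rcases z with _ | ⟨c, z⟩
      · exact absurd rfl h
      · have : (Pi.single none 1 : Option C → ℝ) (some c) = 0 :=
          Pi.single_eq_of_ne (by simp) 1
        exact mul_eq_zero_of_left this _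
  | transfer t child ih =>
    obtain ⟨s, hs⟩ := ih
    refine ⟨(1, s), fun paid => Or.inl rfl, none, rfl, fun _ => rfl, fun ω z h => ?_⟩
    rcases z with _ | z
    · exact absurd rfl h
    · simp [endProb]

end Protocol

/-! ### Recursive evaluation of strategies -/

namespace Protocol

variable {Ω : Type} [Fintype Ω]

/-- The sum over the end nodes of a valuation `g` of the likelihood, net of the payments. -/
noncomputable def value (g : (Ω → ℝ) → ℝ) (q : Ω → ℝ) (P : Protocol Ω) (s : P.Strategy) : ℝ :=
  ∑ z, (g (fun ω => P.endProb s ω z) - evidence q (fun ω => P.endProb s ω z) * P.net z)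

variable {g : (Ω → ℝ) → ℝ} (q : Ω → ℝ)

/-- The buyer's own randomisation does not depend on `ω`, so homogeneity of `g` pulls it out. Taking
`g` to be `gain` yields utility, and `g = 0` yields minus the payment. -/
theorem value_buyer (hg : ∀ c : ℝ, 0 ≤ c → ∀ l, g (fun ω => c * l ω) = c * g l)
    {C : Type} [Fintype C] (child : C → Protocol Ω) (s : (buyer C child).Strategy) :
    value g q (buyer C child) s =
      s.1 none * g 1 + ∑ c, s.1 (some c) * value g q (child c) (s.2 c) := by
  have h1 := hg (s.1 none) (stdSimplex.zero_le _ _) 1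
  simp only [Pi.one_apply, mul_one] at h1
  rw [value, sum_node_buyer]
  simp only [endProb, net, mul_zero, sub_zero, h1, value, Finset.mul_sum]
  congr 1
  refine Finset.sum_congr rfl fun c _ => Finset.sum_congr rfl fun z _ => ?_
  rw [hg _ (stdSimplex.zero_le _ _), evidence_smul]
  ring

theorem sum_evidence_endProb (P : Protocol Ω) (s : P.Strategy) :
    ∑ z, evidence q (fun ω => P.endProb s ω z) = evidence q 1 := by
  rw [← evidence_sum]
  simp only [sum_endProb]
  rfl

theorem value_transfer (hg : ∀ c : ℝ, 0 ≤ c → ∀ l, g (fun ω => c * l ω) = c * g l)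
    (t : ℝ) (child : Protocol Ω) (s : (transfer t child).Strategy) :
    value g q (transfer t child) s =
      (s.1 : ℝ) * g 1 + (1 - (s.1 : ℝ)) * (value g q child s.2 - t * evidence q 1) := by
  have h1 := hg s.1 s.1.2.1 1
  simp only [Pi.one_apply, mul_one] at h1
  rw [value, sum_node_transfer, ← sum_evidence_endProb q child s.2]
  simp only [endProb, net, mul_zero, sub_zero, h1, value, Finset.mul_sum,
    ← Finset.sum_sub_distrib]
  congr 1
  refine Finset.sum_congr rfl fun z _ => ?_
  rw [hg _ (sub_nonneg.2 s.1.2.2), evidence_smul]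
  ring

/-- The seller's probabilities depend on `ω` and stay inside `g`. With only a refund below each
child, leaving or staying there carries the same information, so its two terms recombine. -/
theorem value_seller_refund (hg : ∀ c : ℝ, 0 ≤ c → ∀ l, g (fun ω => c * l ω) = c * g l)
    {C : Type} [Fintype C] (p : Ω → stdSimplex ℝ C) (t : C → ℝ)
    (s : (seller C p fun c => transfer (t c) leaf).Strategy) :
    value g q (seller C p fun c => transfer (t c) leaf) s =
      (s.1 : ℝ) * g 1 + (1 - (s.1 : ℝ)) * ∑ c, (g (fun ω => p ω c) -
        (1 - ((s.2 c).1 : ℝ)) * (t c * evidence q fun ω => p ω c)) := by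
  have h1 := hg s.1 s.1.2.1 1
  simp only [Pi.one_apply, mul_one] at h1
  rw [value, sum_node_seller]
  simp only [sum_node_transfer, sum_node_leaf]
  simp only [endProb, net, mul_zero, sub_zero, add_zero, mul_one, h1, Finset.mul_sum]
  congr 1
  refine Finset.sum_congr rfl fun c _ => ?_
  have h0 : 0 ≤ 1 - (s.1 : ℝ) := sub_nonneg.2 s.1.2.2
  have hx : 0 ≤ ((s.2 c).1 : ℝ) := (s.2 c).1.2.1
  have hy : 0 ≤ 1 - ((s.2 c).1 : ℝ) := sub_nonneg.2 (s.2 c).1.2.2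
  have e1 (x : ℝ) : (fun ω => (1 - (s.1 : ℝ)) * p ω c * x) =
      fun ω => ((1 - (s.1 : ℝ)) * x) * p ω c := by
    funext ω; ring
  rw [e1, e1, hg _ (mul_nonneg h0 hx), hg _ (mul_nonneg h0 hy), evidence_smul]
  ring

end Protocol

/-! ### Payoffs and deviations in the consulting mechanism -/

namespace Environment

open Protocol

variable {Ω Θ A : Type} [Fintype Ω] [Fintype Θ] [Fintype A] (e : Environment Ω Θ A)

theorem refund_nonneg (b : e.B) (i : Bool) : 0 ≤ e.refund b i := by
  unfold refund
  split
  · exact add_nonneg (e.budget_nonneg _ b.2) e.M_nonneg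
  · exact le_rfl

theorem refund_le (b : e.B) (i : Bool) : e.refund b i ≤ b + e.M := by
  unfold refund
  split
  · exact le_rfl
  · exact add_nonneg (e.budget_nonneg _ b.2) e.M_nonneg

/-- The value of the recommendations and refunds after the report `(θ', b')`. -/
noncomputable def reportValue (p : e.Policy) (g : (Ω → ℝ) → ℝ) (q : Ω → ℝ) (θ' : Θ) (b' : e.B) :
    ℝ :=
  ∑ ai : A × Bool, (g (fun ω => p θ' b' ω ai) -
    evidence q (fun ω => p θ' b' ω ai) * (b' - e.refund b' ai.2))

theorem sum_evidence_policy (p : e.Policy) (q : Ω → ℝ) (θ' : Θ) (b' : e.B) :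
    ∑ ai, evidence q (fun ω => p θ' b' ω ai) = evidence q 1 := by
  rw [← evidence_sum]
  simp only [stdSimplex.sum_eq_one]
  rfl

theorem value_consult {g : (Ω → ℝ) → ℝ}
    (hg : ∀ c : ℝ, 0 ≤ c → ∀ l, g (fun ω => c * l ω) = c * g l) (q : Ω → ℝ)
    (p : e.Policy) (θ' : Θ) (b' : e.B) (s : (e.consult p θ' b').Strategy) :
    value g q (e.consult p θ' b') s = (s.1 : ℝ) * g 1 + (1 - (s.1 : ℝ)) *
      ((s.2.1 : ℝ) * g 1 + (1 - (s.2.1 : ℝ)) * ∑ ai : A × Bool, (g (fun ω => p θ' b' ω ai) +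
        (1 - ((s.2.2 ai).1 : ℝ)) * (e.refund b' ai.2 * evidence q fun ω => p θ' b' ω ai))
        - b' * evidence q 1) := by
  refine (value_transfer q hg _ _ _).trans ?_
  rw [value_seller_refund q hg]
  simp only [neg_mul, mul_neg, sub_neg_eq_add]

theorem reportValue_eq (p : e.Policy) (g : (Ω → ℝ) → ℝ) (q : Ω → ℝ) (θ' : Θ) (b' : e.B) :
    e.reportValue p g q θ' b' = ∑ ai : A × Bool, (g (fun ω => p θ' b' ω ai) +
      e.refund b' ai.2 * evidence q fun ω => p θ' b' ω ai) - b' * evidence q 1 := by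
  rw [← e.sum_evidence_policy p q θ' b', reportValue, Finset.mul_sum, ← Finset.sum_sub_distrib]
  exact Finset.sum_congr rfl fun _ _ => by ring

theorem value_complete {g : (Ω → ℝ) → ℝ}
    (hg : ∀ c : ℝ, 0 ≤ c → ∀ l, g (fun ω => c * l ω) = c * g l) (q : Ω → ℝ)
    (p : e.Policy) (θ' : Θ) (b' : e.B) {b : ℝ} (h : (b' : ℝ) ≤ b) :
    value g q (e.consult p θ' b') (e.complete p b θ' b') = e.reportValue p g q θ' b' := by
  rw [value_consult e hg, reportValue_eq]
  simp [complete, h]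

theorem choose_some_self {C : Type} [Fintype C] (c : C) :
    choose c (some c) = 1 := by
  classical
  simp only [choose, DFunLike.coe]
  convert Pi.single_eq_same (M := fun _ : Option C => ℝ) (some c) 1

theorem choose_of_ne {C : Type} [Fintype C] {c : C} {x : Option C} (h : x ≠ some c) :
    choose c x = 0 := by
  classical
  simp only [choose, DFunLike.coe]
  convert Pi.single_eq_of_ne (M := fun _ : Option C => ℝ) h 1

theorem value_buyer_choose {g : (Ω → ℝ) → ℝ}
    (hg : ∀ c : ℝ, 0 ≤ c → ∀ l, g (fun ω => c * l ω) = c * g l) (q : Ω → ℝ)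
    {C : Type} [Fintype C] (child : C → Protocol Ω) (c : C)
    (s : (c : C) → (child c).Strategy) :
    value g q (.buyer C child) (choose c, s) = value g q (child c) (s c) := by
  refine (value_buyer q hg child _).trans ?_
  change choose c none * g 1 + ∑ c', choose c (some c') * value g q (child c') (s c') = _
  rw [choose_of_ne (by simp), Fintype.sum_eq_single c, choose_some_self]
  · ring
  · intro c' h
    rw [choose_of_ne (by simpa using h), zero_mul]

theorem value_buyer_le {g : (Ω → ℝ) → ℝ}
    (hg : ∀ c : ℝ, 0 ≤ c → ∀ l, g (fun ω => c * l ω) = c * g l) (q : Ω → ℝ)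
    {C : Type} [Fintype C] (child : C → Protocol Ω) (s : (buyer C child).Strategy) {x : ℝ}
    (h1 : g 1 ≤ x) (h : ∀ c, value g q (child c) (s.2 c) ≤ x) :
    value g q (.buyer C child) s ≤ x := by
  rw [value_buyer q hg]
  calc _ ≤ s.1 none * x + ∑ c, s.1 (some c) * x := by
        gcongr with c
        · exact stdSimplex.zero_le _ _
        · exact stdSimplex.zero_le _ _
        · exact h c
    _ = x := by
        rw [← Fintype.sum_option (fun c => s.1 c * x), ← Finset.sum_mul, stdSimplex.sum_eq_one,
          one_mul]

theorem expectedPayment_eq (θ : Θ) (b : e.B) (P : Protocol Ω) (s : P.Strategy) :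
    e.expectedPayment θ b P s = -value (fun _ => 0) (e.belief θ b) P s := by
  simp [expectedPayment, value]

/-- Affordability is also required after reports that are not made; leaving before an excessive
deposit secures it. -/
theorem affordable_complete (p : e.Policy) {b : ℝ} (θ' : Θ) (b' : e.B) :
    (e.consult p θ' b').Affordable b (e.complete p b θ' b') 0 := by
  by_cases h : (b' : ℝ) ≤ b
  · refine Or.inr ⟨by simpa using h, fun ai => Or.inr ⟨?_, trivial⟩⟩
    have := e.refund_nonneg b' ai.2
    linarith
  · left
    simp [complete, h]

theorem withinSellerBudget_consult (p : e.Policy) (θ' : Θ) (b' : e.B) :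
    (e.consult p θ' b').WithinSellerBudget e.M := by
  have hM := e.M_nonneg
  have hb := e.budget_nonneg _ b'.2
  intro z
  rcases z with _ | _ | ⟨ai, _ | _⟩
  · simpa [consult, net] using hM
  · simp only [consult, net]; linarith
  · simp only [consult, net]; linarith
  · have := e.refund_le b' ai.2
    simp only [consult, net]; linarith

theorem withinSellerBudget_buyer {C : Type} [Fintype C] (child : C → Protocol Ω)
    (h : ∀ c, (child c).WithinSellerBudget e.M) :
    (Protocol.buyer C child).WithinSellerBudget e.M := by
  intro z
  rcases z with _ | ⟨c, z⟩
  · simpa [net] using e.M_nonneg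
  · exact h c z

variable [Nonempty A]

theorem utility_eq (θ : Θ) (b : e.B) (P : Protocol Ω) (s : P.Strategy) :
    e.utility θ b P s = value (e.gain θ (e.belief θ b)) (e.belief θ b) P s := by
  refine Finset.sum_congr rfl fun z _ => ?_
  rw [mul_sub, e.evidence_mul_bestValue θ (e.belief_nonneg θ b)]
  exact fun ω => P.endProb_nonneg s ω z

/-- Leaving before the deposit yields the outside option; leaving later sacrifices the
recommendation or the refund. Every strategy is a mixture of these, so only full participation and
immediate exit need bounds. -/
theorem value_consult_le (θ : Θ) {q : Ω → ℝ} (hq : 0 ≤ q) (p : e.Policy) (θ' : Θ) (b' : e.B)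
    (s : (e.consult p θ' b').Strategy) {b x : ℝ} (hs : (e.consult p θ' b').Affordable b s 0)
    (h1 : e.gain θ q 1 ≤ x) (h : (b' : ℝ) ≤ b → e.reportValue p (e.gain θ q) q θ' b' ≤ x) :
    value (e.gain θ q) q (e.consult p θ' b') s ≤ x := by
  rw [value_consult e (fun c hc l => e.gain_smul θ q hc l)]
  rcases hs with hs | ⟨hs, -⟩
  · rw [hs]
    simpa using h1
  rw [zero_add] at hs
  have hW := h hs
  rw [reportValue_eq] at hW
  set T := ∑ ai : A × Bool, (e.gain θ q (fun ω => p θ' b' ω ai) +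
      e.refund b' ai.2 * evidence q fun ω => p θ' b' ω ai)
  have hr (ai : A × Bool) : 0 ≤ e.refund b' ai.2 * evidence q fun ω => p θ' b' ω ai :=
    mul_nonneg (e.refund_nonneg _ _) (evidence_nonneg hq fun ω => stdSimplex.zero_le _ _)
  have hT : ∑ ai : A × Bool, (e.gain θ q (fun ω => p θ' b' ω ai) +
      (1 - ((s.2.2 ai).1 : ℝ)) * (e.refund b' ai.2 * evidence q fun ω => p θ' b' ω ai)) ≤ T := by
    refine Finset.sum_le_sum fun ai _ => add_le_add_right ?_ _
    have := (s.2.2 ai).1.2.1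
    exact mul_le_of_le_one_left (hr ai) (by linarith)
  -- Free information and nonnegative refunds are worth at least acting on the prior.
  have h1T : e.gain θ q 1 ≤ T := by
    have h2 := e.gain_sum_le θ q fun (ai : A × Bool) ω => p θ' b' ω ai
    simp only [stdSimplex.sum_eq_one] at h2
    exact h2.trans (Finset.sum_le_sum fun ai _ => le_add_of_nonneg_right (hr ai))
  have hs0 := s.1.2.1
  have hs1 := s.1.2.2
  have ht0 := s.2.1.2.1
  have ht1 := s.2.1.2.2
  have hin := add_le_add (mul_le_mul_of_nonneg_left h1T ht0)
    (mul_le_mul_of_nonneg_left hT (sub_nonneg.2 ht1))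
  have hin' := (sub_le_sub_right hin (b' * evidence q 1)).trans
    (by linarith : _ ≤ x)
  have := add_le_add (mul_le_mul_of_nonneg_left h1 hs0)
    (mul_le_mul_of_nonneg_left hin' (sub_nonneg.2 hs1))
  linarith

end Environment

/-! ### Garbling a protocol into a recommendation policy -/

namespace Environment

open Protocol

variable {Ω Θ A : Type} [Fintype Ω] [Fintype Θ] [Fintype A] (e : Environment Ω Θ A)

/-- The probability of the return after which the expected net payment out of the deposit `b` is
`x`. -/
noncomputable def returnProb (b x : ℝ) : ℝ := max 0 (min 1 ((b - x) / (b + e.M)))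

theorem returnProb_nonneg (b x : ℝ) : 0 ≤ e.returnProb b x := le_max_left _ _

theorem returnProb_le_one (b x : ℝ) : e.returnProb b x ≤ 1 :=
  max_le zero_le_one (min_le_left _ _)

theorem sub_returnProb_mul {b x : ℝ} (hx : x ≤ b) (hx' : -x ≤ e.M) :
    b - e.returnProb b x * (b + e.M) = x := by
  rcases (show 0 ≤ b + e.M by linarith).eq_or_lt with h | h
  -- If `b + M = 0`, the two bounds force `x = b`, and no return is needed.
  · rw [← h, mul_zero]
    linarith
  · have h0 : 0 ≤ (b - x) / (b + e.M) := div_nonneg (by linarith) h.le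
    have h1 : (b - x) / (b + e.M) ≤ 1 := (div_le_one h).2 (by linarith)
    rw [returnProb, min_eq_right h1, max_eq_right h0, div_mul_cancel₀ _ h.ne']
    ring

open Classical in
/-- The recommendation of `a`, with the full amount returned with probability `x`. -/
noncomputable def recommend (a : A) (x : ℝ) (ai : A × Bool) : ℝ :=
  if ai.1 = a then (if ai.2 then x else 1 - x) else 0

theorem recommend_nonneg {A : Type} {a : A} {x : ℝ} (h0 : 0 ≤ x) (h1 : x ≤ 1) (ai : A × Bool) :
    0 ≤ recommend a x ai := by
  unfold recommend
  split_ifs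
  exacts [h0, sub_nonneg.2 h1, le_rfl]

theorem sum_recommend_mul (a : A) (x : ℝ) (f : A × Bool → ℝ) :
    ∑ ai, recommend a x ai * f ai = x * f (a, true) + (1 - x) * f (a, false) := by
  classical
  rw [Fintype.sum_prod_type, Fintype.sum_eq_single a]
  · simp [recommend]
  · intro a' h
    simp [recommend, h]

theorem sum_recommend (a : A) (x : ℝ) : ∑ ai, recommend a x ai = 1 := by
  have := sum_recommend_mul a x fun _ => 1
  simp only [mul_one] at this
  linarith

/-- The distribution of recommendations and returns when the outcome of the protocol `P` at an end
node `z` is replaced by the recommendation of `α z` and a return of the same expected value. -/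
noncomputable def garble (P : Protocol Ω) (s : P.Strategy) (b : ℝ) (α : P.Node → A) (ω : Ω) :
    stdSimplex ℝ (A × Bool) :=
  ⟨fun ai => ∑ z, recommend (α z) (e.returnProb b (P.net z)) ai * P.endProb s ω z,
    fun _ => Finset.sum_nonneg fun z _ => mul_nonneg
      (recommend_nonneg (e.returnProb_nonneg _ _) (e.returnProb_le_one _ _) _)
      (P.endProb_nonneg s ω z), by
    rw [Finset.sum_comm]
    simp only [← Finset.sum_mul, sum_recommend, one_mul]
    exact P.sum_endProb s ω⟩

theorem garble_apply (P : Protocol Ω) (s : P.Strategy) (b : ℝ) (α : P.Node → A) (ω : Ω)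
    (ai : A × Bool) : e.garble P s b α ω ai =
      ∑ z, recommend (α z) (e.returnProb b (P.net z)) ai * P.endProb s ω z := rfl

/-- The lottery has the right mean node by node, so the identity holds for arbitrary `q`, in
particular for the beliefs of misreporting buyers. -/
theorem sum_evidence_garble {P : Protocol Ω} (hP : P.WithinSellerBudget e.M) {s : P.Strategy}
    {b : e.B} (hs : P.Affordable b s 0) (α : P.Node → A) (q : Ω → ℝ) :
    ∑ ai, evidence q (fun ω => e.garble P s b α ω ai) * (b - e.refund b ai.2) =
      ∑ z, evidence q (fun ω => P.endProb s ω z) * P.net z := by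
  simp only [garble_apply, evidence_sum, evidence_smul, Finset.sum_mul]
  rw [Finset.sum_comm]
  refine Finset.sum_congr rfl fun z _ => ?_
  have h1 (ai : A × Bool) : recommend (α z) (e.returnProb b (P.net z)) ai *
      evidence q (fun ω => P.endProb s ω z) * (b - e.refund b ai.2) =
      recommend (α z) (e.returnProb b (P.net z)) ai *
        (evidence q (fun ω => P.endProb s ω z) * (b - e.refund b ai.2)) := mul_assoc _ _ _
  simp only [h1, sum_recommend_mul]
  -- Only a reached node is known to have net payment at most `b`; elsewhere the return probability
  -- may be clamped, but the evidence is zero.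
  by_cases h : ∃ ω, P.endProb s ω z ≠ 0
  · obtain ⟨ω, hω⟩ := h
    have hb := hs.add_net_le (e.budget_nonneg _ b.2) hω
    rw [zero_add] at hb
    have := e.sub_returnProb_mul hb (hP z)
    simp only [refund, if_true, Bool.false_eq_true, if_false]
    linear_combination evidence q (fun ω => P.endProb s ω z) * this
  · push Not at h
    simp [evidence, h]

/-- The revenue of a recommendation policy under truthful participation. -/
noncomputable def policyRevenue (e : Environment Ω Θ A) (p : e.Policy) : ℝ :=
  ∑ θ, ∑ b : e.B, e.typeProb θ b * -e.reportValue p (fun _ => 0) (e.belief θ b) θ b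

theorem revenue_truthfulPublic (p : e.Policy) :
    e.revenue (fun b => e.publicCMProbR p b) (fun θ b => e.truthfulPublic p θ b) =
      e.policyRevenue p := by
  refine Finset.sum_congr rfl fun θ _ => Finset.sum_congr rfl fun b _ => ?_
  rw [expectedPayment_eq]
  congr 2
  exact (value_buyer_choose (by simp) _ _ θ _).trans (e.value_complete (by simp) _ p θ b le_rfl)

theorem revenue_truthfulPrivate (p : e.Policy) :
    e.revenue (fun _ => e.privateCMProbR p) (fun θ b => e.truthfulPrivate p θ b) =
      e.policyRevenue p := by
  refine Finset.sum_congr rfl fun θ _ => Finset.sum_congr rfl fun b _ => ?_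
  rw [expectedPayment_eq]
  congr 2
  exact (value_buyer_choose (by simp) _ _ (θ, b) _).trans
    (e.value_complete (by simp) _ p θ b le_rfl)

theorem continuous_policy_apply (θ : Θ) (b : e.B) (ω : Ω) (ai : A × Bool) :
    Continuous fun p : e.Policy => p θ b ω ai :=
  (continuous_apply ai).comp <| continuous_subtype_val.comp <|
    (continuous_apply ω).comp <| (continuous_apply b).comp (continuous_apply θ)

variable [Nonempty A]

/-- The signal `(a, i)` pools only nodes with `α z = a`, and the optimality inequalities at these
nodes add up. -/
theorem obedient_garble (P : Protocol Ω) (s : P.Strategy) (b : ℝ) {α : P.Node → A} {θ : Θ}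
    {q : Ω → ℝ} (hα : ∀ z, e.actionGain θ q (α z) (fun ω => P.endProb s ω z) =
      e.gain θ q fun ω => P.endProb s ω z) (a : A) (i : Bool) (a' : A) :
    e.actionGain θ q a' (fun ω => e.garble P s b α ω (a, i)) ≤
      e.actionGain θ q a (fun ω => e.garble P s b α ω (a, i)) := by
  simp only [garble_apply, actionGain_sum, actionGain_smul]
  refine Finset.sum_le_sum fun z _ => ?_
  by_cases h : a = α z
  · refine mul_le_mul_of_nonneg_left ?_
      (recommend_nonneg (e.returnProb_nonneg _ _) (e.returnProb_le_one _ _) _)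
    rw [h, hα]
    exact e.actionGain_le_gain θ q a' _
  · simp [recommend, h]

theorem sum_gain_garble_le (P : Protocol Ω) (s : P.Strategy) (b : ℝ) (α : P.Node → A) (θ : Θ)
    (q : Ω → ℝ) : ∑ ai, e.gain θ q (fun ω => e.garble P s b α ω ai) ≤
      ∑ z, e.gain θ q fun ω => P.endProb s ω z := by
  calc _ ≤ ∑ ai, ∑ z, recommend (α z) (e.returnProb b (P.net z)) ai *
        e.gain θ q fun ω => P.endProb s ω z := by
        refine Finset.sum_le_sum fun ai _ => ?_
        simp only [garble_apply]
        refine (e.gain_sum_le θ q fun z ω => _).trans (Finset.sum_le_sum fun z _ => ?_)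
        exact (e.gain_smul θ q (recommend_nonneg (e.returnProb_nonneg _ _)
          (e.returnProb_le_one _ _) _) _).le
    _ = _ := by
        rw [Finset.sum_comm]
        simp only [← Finset.sum_mul, sum_recommend, one_mul]

/-- Simply obeying already recovers the best payoff of every end node, so the garbling costs a
truthful buyer nothing. -/
theorem le_sum_gain_garble (P : Protocol Ω) (s : P.Strategy) (b : ℝ) {α : P.Node → A} {θ : Θ}
    {q : Ω → ℝ} (hα : ∀ z, e.actionGain θ q (α z) (fun ω => P.endProb s ω z) =
      e.gain θ q fun ω => P.endProb s ω z) :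
    ∑ z, e.gain θ q (fun ω => P.endProb s ω z) ≤
      ∑ ai, e.gain θ q (fun ω => e.garble P s b α ω ai) := by
  calc _ = ∑ ai : A × Bool, e.actionGain θ q ai.1 (fun ω => e.garble P s b α ω ai) := by
        simp only [garble_apply, actionGain_sum, actionGain_smul]
        rw [Finset.sum_comm]
        refine Finset.sum_congr rfl fun z _ => ?_
        rw [sum_recommend_mul, hα]
        ring
    _ ≤ _ := Finset.sum_le_sum fun ai _ => e.actionGain_le_gain θ q ai.1 _

theorem gain_one_le_utility {θ : Θ} {b : e.B} {P : Protocol Ω} {s : P.Strategy}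
    (hs : e.IsBestResponse θ b P s) :
    e.gain θ (e.belief θ b) 1 ≤ value (e.gain θ (e.belief θ b)) (e.belief θ b) P s := by
  obtain ⟨s', h1, z, h2, h3, h4⟩ := P.exists_leave b
  have h := hs.2 s' (h1 0)
  rw [utility_eq, utility_eq] at h
  refine le_trans (le_of_eq ?_) h
  have h0 : e.gain θ (e.belief θ b) (fun _ => 0) = 0 := by
    simpa using e.gain_smul θ (e.belief θ b) le_rfl 0
  rw [value, Fintype.sum_eq_single z]
  · simp only [h3, h2, mul_zero, sub_zero]
    rfl
  · intro z' hz
    simp only [h4 _ z' hz, h0]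
    simp [evidence]

/-- Truthful reporting is optimal among the reports that `R` allows for each budget, and
participation is optimal. -/
def IncentiveCompatible (R : e.B → e.B → Prop) (p : e.Policy) : Prop :=
  ∀ θ b, e.gain θ (e.belief θ b) 1 ≤
      e.reportValue p (e.gain θ (e.belief θ b)) (e.belief θ b) θ b ∧
    ∀ θ' b', R b b' → e.reportValue p (e.gain θ (e.belief θ b)) (e.belief θ b) θ' b' ≤
      e.reportValue p (e.gain θ (e.belief θ b)) (e.belief θ b) θ b

/-- The relation `R` lists the budget reports to be deterred: equality for public budgets, no
over-reporting for private ones. The hypothesis `hR` says that imitating such a type does not pay in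
`Q`. -/
theorem exists_policy_of_isRational {R : e.B → e.B → Prop} {Q : e.B → Protocol Ω}
    (hQ : ∀ b, (Q b).WithinSellerBudget e.M) {r : (θ : Θ) → (b : e.B) → (Q b).Strategy}
    (hr : e.IsRational Q r)
    (hR : ∀ θ b θ' b', R b b' → value (e.gain θ (e.belief θ b)) (e.belief θ b) (Q b') (r θ' b') ≤
      e.utility θ b (Q b) (r θ b)) :
    ∃ p : e.Policy, e.Obedient p ∧ e.IncentiveCompatible R p ∧
      e.policyRevenue p = e.revenue Q r := by
  choose α hα using fun θ b (z : (Q b).Node) => e.exists_actionGain_eq_gain θ (e.belief θ b)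
    fun ω => (Q b).endProb (r θ b) ω z
  let p : e.Policy := fun θ b => e.garble (Q b) (r θ b) b (α θ b)
  have hle (θ : Θ) (q : Ω → ℝ) (θ' : Θ) (b' : e.B) :
      e.reportValue p (e.gain θ q) q θ' b' ≤ value (e.gain θ q) q (Q b') (r θ' b') := by
    rw [reportValue, value, Finset.sum_sub_distrib, Finset.sum_sub_distrib,
      e.sum_evidence_garble (hQ b') (hr θ' b').1]
    exact sub_le_sub_right (e.sum_gain_garble_le _ _ _ _ _ _) _
  have hge (θ : Θ) (b : e.B) : value (e.gain θ (e.belief θ b)) (e.belief θ b) (Q b) (r θ b) ≤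
      e.reportValue p (e.gain θ (e.belief θ b)) (e.belief θ b) θ b := by
    rw [reportValue, value, Finset.sum_sub_distrib, Finset.sum_sub_distrib,
      e.sum_evidence_garble (hQ b) (hr θ b).1]
    exact sub_le_sub_right (e.le_sum_gain_garble _ _ _ (hα θ b)) _
  refine ⟨p, (e.obedient_iff p).2 fun θ b a i a' => e.obedient_garble _ _ _ (hα θ b) a i a',
    fun θ b => ⟨(e.gain_one_le_utility (hr θ b)).trans (hge θ b), fun θ' b' hb => ?_⟩, ?_⟩
  · have := hR θ b θ' b' hb
    rw [utility_eq] at this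
    exact ((hle _ _ _ _).trans this).trans (hge θ b)
  · refine Finset.sum_congr rfl fun θ _ => Finset.sum_congr rfl fun b _ => ?_
    rw [expectedPayment, ← e.sum_evidence_garble (hQ b) (hr θ b).1 (α θ b), reportValue]
    simp only [zero_sub, Finset.sum_neg_distrib, neg_neg]
    rfl

/-! ### Compactness and optimality of truthful participation -/

theorem exists_optimal_policy (R : e.B → e.B → Prop) :
    ∃ p : e.Policy, e.Obedient p ∧ e.IncentiveCompatible R p ∧
      ∀ p' : e.Policy, e.Obedient p' → e.IncentiveCompatible R p' →
        e.policyRevenue p' ≤ e.policyRevenue p := by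
  have hc := e.continuous_policy_apply
  have hA (θ : Θ) (q : Ω → ℝ) (a : A) (θ' : Θ) (b' : e.B) (ai : A × Bool) :
      Continuous fun p : e.Policy => e.actionGain θ q a fun ω => p θ' b' ω ai := by
    exact continuous_finsetSum _ fun ω _ =>
      continuous_const.mul (continuous_const.mul (hc θ' b' ω ai))
  have hE (q : Ω → ℝ) (θ' : Θ) (b' : e.B) (ai : A × Bool) :
      Continuous fun p : e.Policy => evidence q fun ω => p θ' b' ω ai := by
    exact continuous_finsetSum _ fun ω _ => continuous_const.mul (hc θ' b' ω ai)
  have hG (θ : Θ) (q : Ω → ℝ) (θ' : Θ) (b' : e.B) (ai : A × Bool) :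
      Continuous fun p : e.Policy => e.gain θ q fun ω => p θ' b' ω ai :=
    Continuous.finset_sup'_apply _ fun a _ => hA θ q a θ' b' ai
  have hV (θ : Θ) (q : Ω → ℝ) (θ' : Θ) (b' : e.B) :
      Continuous fun p : e.Policy => e.reportValue p (e.gain θ q) q θ' b' := by
    unfold reportValue; fun_prop
  have hZ : Continuous fun p : e.Policy => e.policyRevenue p := by
    unfold policyRevenue reportValue; fun_prop
  have hclosed : IsClosed {p : e.Policy | e.Obedient p ∧ e.IncentiveCompatible R p} := by
    simp only [obedient_iff, IncentiveCompatible, Set.ofPred_and, Set.ofPred_forall]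
    refine IsClosed.inter ?_ ?_
    · exact isClosed_iInter fun θ => isClosed_iInter fun b => isClosed_iInter fun a =>
        isClosed_iInter fun i => isClosed_iInter fun a' => isClosed_le (hA _ _ _ _ _ _)
          (hA _ _ _ _ _ _)
    · exact isClosed_iInter fun θ => isClosed_iInter fun b =>
        (isClosed_le continuous_const (hV _ _ _ _)).inter <|
          isClosed_iInter fun θ' => isClosed_iInter fun b' => isClosed_iInter fun _ =>
            isClosed_le (hV _ _ _ _) (hV _ _ _ _)
  have hne : {p : e.Policy | e.Obedient p ∧ e.IncentiveCompatible R p}.Nonempty := by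
    -- Garbling the one-leaf protocol, where no imitation matters, supplies a feasible policy.
    obtain ⟨p, h1, h2, -⟩ := e.exists_policy_of_isRational (R := R) (Q := fun _ => .leaf)
      (r := fun _ _ => ()) (fun _ _ => by simpa [net] using e.M_nonneg)
      (fun θ b => ⟨trivial, fun _ _ => le_rfl⟩)
      (fun θ b θ' b' _ => (e.utility_eq θ b _ _).ge)
    exact ⟨p, h1, h2⟩
  obtain ⟨p, hp, hmax⟩ := hclosed.isCompact.exists_isMaxOn hne hZ.continuousOn
  exact ⟨p, hp.1, hp.2, fun p' h1 h2 => hmax ⟨h1, h2⟩⟩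

theorem gain_hom (θ : Θ) (q : Ω → ℝ) (c : ℝ) (hc : 0 ≤ c) (l : Ω → ℝ) :
    e.gain θ q (fun ω => c * l ω) = c * e.gain θ q l :=
  e.gain_smul θ q hc l

theorem isRational_public {p : e.Policy}
    (hp : e.IncentiveCompatible (fun b b' => b' = b) p) :
    e.IsRational (fun b => e.publicCMProbR p b) (fun θ b => e.truthfulPublic p θ b) := by
  refine fun θ b => ⟨fun θ' => e.affordable_complete p θ' b, fun s hs => ?_⟩
  rw [utility_eq, utility_eq]
  refine le_of_le_of_eq (value_buyer_le (e.gain_hom θ _) _ _ s (hp θ b).1 fun θ' => ?_)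
    ((value_buyer_choose (e.gain_hom θ _) _ _ θ _).trans
      (e.value_complete (e.gain_hom θ _) _ p θ b le_rfl)).symm
  exact e.value_consult_le θ (e.belief_nonneg θ b) p θ' b _ (hs θ') (hp θ b).1
    fun _ => (hp θ b).2 θ' b rfl

/-- A report above the true budget leaves only exit before the deposit, so `R` need not cover it. -/
theorem isRational_private {p : e.Policy}
    (hp : e.IncentiveCompatible (fun b b' => (b' : ℝ) ≤ b) p) :
    e.IsRational (fun _ => e.privateCMProbR p) (fun θ b => e.truthfulPrivate p θ b) := by
  refine fun θ b => ⟨fun c => e.affordable_complete p c.1 c.2, fun s hs => ?_⟩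
  rw [utility_eq, utility_eq]
  refine le_of_le_of_eq (value_buyer_le (e.gain_hom θ _) _ _ s (hp θ b).1 fun c => ?_)
    ((value_buyer_choose (e.gain_hom θ _) _ _ (θ, b) _).trans
      (e.value_complete (e.gain_hom θ _) _ p θ b le_rfl)).symm
  exact e.value_consult_le θ (e.belief_nonneg θ b) p c.1 c.2 _ (hs c) (hp θ b).1
    fun h => (hp θ b).2 c.1 c.2 h

end Environment

end InfoSale

theorem theorem2 {Ω Θ A : Type} [Fintype Ω] [Fintype Θ] [Fintype A] [Nonempty A]
    (e : InfoSale.Environment Ω Θ A) :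
    (∃ p : e.Policy, e.Obedient p ∧
      e.MaximizesRevenue e.publicDesigns (fun b => e.publicCMProbR p b)
        (fun θ b => e.truthfulPublic p θ b)) ∧
    (∃ p : e.Policy, e.Obedient p ∧
      e.MaximizesRevenue e.privateDesigns (fun _ => e.privateCMProbR p)
        (fun θ b => e.truthfulPrivate p θ b)) := by
  constructor
  · obtain ⟨p, hp, hIC, hmax⟩ := e.exists_optimal_policy fun b b' => b' = b
    refine ⟨p, hp, fun b => e.withinSellerBudget_buyer _ fun θ =>
      e.withinSellerBudget_consult p θ b, e.isRational_public hIC, fun Q hQ r hr => ?_⟩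
    obtain ⟨p', h1, h2, h3⟩ := e.exists_policy_of_isRational (R := fun b b' => b' = b) hQ hr <| by
      rintro θ b θ' _ rfl
      rw [← e.utility_eq]
      exact (hr θ _).2 _ (hr θ' _).1
    rw [← h3, e.revenue_truthfulPublic]
    exact hmax p' h1 h2
  · obtain ⟨p, hp, hIC, hmax⟩ := e.exists_optimal_policy fun b b' => (b' : ℝ) ≤ b
    refine ⟨p, hp, ⟨_, e.withinSellerBudget_buyer _ fun c : Θ × e.B =>
      e.withinSellerBudget_consult p c.1 c.2, rfl⟩, e.isRational_private hIC, fun Q hQ r hr => ?_⟩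
    obtain ⟨P, hP, rfl⟩ := hQ
    obtain ⟨p', h1, h2, h3⟩ := e.exists_policy_of_isRational (R := fun b b' => (b' : ℝ) ≤ b)
      (fun _ => hP) hr <| by
        -- Behaviour affordable with `b'` remains affordable with the larger budget `b`, so it is a
        -- legitimate deviation in the common protocol.
        intro θ b θ' b' hb
        rw [← e.utility_eq]
        exact (hr θ b).2 _ ((hr θ' b').1.mono hb)
    rw [← h3, e.revenue_truthfulPrivate]
    exact hmax p' h1 h2
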